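/- Let $k$ be a field, let $n\ge 1$, and let $C_{2n+1}$ be the cycle on the vertices $x_1,\dots,x_{2n+1}$. Let $R=k[x_1,\dots,x_{2n+1}]$ and let $I=I(C_{2n+1})=(x_1x_2,\,x_2x_3,\,\dots,\,x_{2n}x_{2n+1},\,x_{2n+1}x_1)$ be its edge ideal; the listed generators are called the edge monomials. For $t\ge 1$ let $I^{(t)}=R\cap\bigcap_{P\in\operatorname{Ass}(R/I)}I^tR_P$ be the $t$-th symbolic power of $I$, and let the symbolic defect $\operatorname{sdefect}(I,t)$ be the minimal number of generators of the $R$-module $I^{(t)}/I^t$. For integers $\ell\ge 1$ and $q$ let $\left(\!\binom{\ell}{q}\!\right)$ be the number of multisets of size $q$ with elements in an $\ell$-element set, that is, $\binom{\ell+q-1}{q}$ if $q\ge 0$, and $0$ if $q<0$. Then for every integer $t$ with $n+2\le t\le 2n+1$, $$\operatorname{sdefect}(I,t)=\sum_{\ell=1}^{2n+1}\binom{2n+1}{\ell}\left(\!\binom{\ell}{t-(n+1)-\ell}\!\right).$$ Moreover, this is the number of distinct monomials of the form $x_1x_2\cdots x_{2n+1}\cdot p$, where $p$ is a product of $t-n-1$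 edge monomials (repetitions allowed), and these monomials generate $I^{(t)}$ modulo $I^t$, i.e. $I^{(t)}$ is the sum of $I^t$ and the ideal that they generate. -/

import Mathlib

/-- The `m`-th symbolic power of an ideal `I`:
`I^(m) = R ∩ ⋂_{P ∈ Ass(R/I)} I^m R_P`, where the intersection with `R` is taken by contracting
each `I^m R_P` along the localization map `R → R_P`. -/
noncomputable def symbolicPower {R : Type*} [CommRing R] (I : Ideal R) (m : ℕ) : Ideal R :=
  ⨅ (P : Ideal R) (hP : P ∈ associatedPrimes R (R ⧸ I)),
    haveI : P.IsPrime := hP.isPrime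
    ((I ^ m).map (algebraMap R (Localization.AtPrime P))).comap
      (algebraMap R (Localization.AtPrime P))

/-- The symbolic defect `sdefect(I, m)`: the minimal number of generators of the `R`-module
`I^(m) / I^m`. (The submodule in the quotient is `I^m ∩ I^(m)`, which is `I^m`.) -/
noncomputable def symbolicDefect {R : Type*} [CommRing R] (I : Ideal R) (m : ℕ) : ℕ :=
  (⊤ : Submodule R
    (↥(symbolicPower I m) ⧸ Submodule.submoduleOf (I ^ m) (symbolicPower I m))).spanFinrank

/-- The edge monomials `x_i x_j`, `{i, j}` an edge of `G`, in the polynomial ring over `k` whose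
variables are the vertices of `G`. -/
def edgeMonomials (k : Type*) [Field k] {V : Type*} (G : SimpleGraph V) :
    Set (MvPolynomial V k) :=
  {f | ∃ i j : V, G.Adj i j ∧ f = MvPolynomial.X i * MvPolynomial.X j}

/-- The edge ideal `I(G)`, generated by the edge monomials of `G`. -/
noncomputable def edgeIdeal (k : Type*) [Field k] {V : Type*} (G : SimpleGraph V) :
    Ideal (MvPolynomial V k) :=
  Ideal.span (edgeMonomials k G)

/-- The monomials `(∏_v x_v) * p`, where `p` is a product of exactly `s` edge monomials of `G`,
repetitions being allowed. -/
def vertexProductTimesEdges (k : Type*) [Field k] {V : Type*} [Fintype V] (G : SimpleGraph V)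
    (s : ℕ) : Set (MvPolynomial V k) :=
  {f | ∃ E : Multiset (MvPolynomial V k), (∀ e ∈ E, e ∈ edgeMonomials k G) ∧ E.card = s ∧
    f = (∏ v : V, MvPolynomial.X v) * E.prod}

/-- The number of multisets with `q` elements taken from an `l`-element set, for an integer `q`:
it is `0` for negative `q`. -/
def intMultichoose (l : ℕ) (q : ℤ) : ℕ :=
  if 0 ≤ q then Nat.multichoose l q.toNat else 0

namespace MvPolynomial

/-! ### Weights of monomials as a `T`-adic valuation -/

variable {σ k : Type*} [DecidableEq σ] [Field k]

/-- The substitution `X v ↦ T * X v` for `v ∈ W`, `X v ↦ X v` otherwise, into `k[σ][T]`. -/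
noncomputable def weightHom (k : Type*) [Field k] (W : Finset σ) :
    MvPolynomial σ k →ₐ[k] Polynomial (MvPolynomial σ k) :=
  aeval fun v => if v ∈ W then Polynomial.X * Polynomial.C (X v) else Polynomial.C (X v)

theorem weightHom_monomial (W : Finset σ) (m : σ →₀ ℕ) (c : k) :
    weightHom k W (monomial m c) =
      Polynomial.X ^ (∑ v ∈ W, m v) * Polynomial.C (monomial m c) := by
  have h1 : ∀ v, (if v ∈ W then Polynomial.X * Polynomial.C (X v) else Polynomial.C (X v) :
      Polynomial (MvPolynomial σ k)) =
      (if v ∈ W then Polynomial.X else 1) * Polynomial.C (X v) := by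
    intro v; split_ifs <;> simp
  have h2 : (m.prod fun v e => (if v ∈ W then Polynomial.X else 1 :
      Polynomial (MvPolynomial σ k)) ^ e) = Polynomial.X ^ (∑ v ∈ W, m v) := by
    simp only [Finsupp.prod, ite_pow, one_pow, Finset.prod_ite_mem]
    rw [Finset.prod_pow_eq_pow_sum]
    congr 1
    refine Finset.sum_subset Finset.inter_subset_right fun v hv hv' => ?_
    simpa [hv] using hv'
  rw [weightHom, aeval_monomial]
  simp only [h1, mul_pow]
  rw [Finsupp.prod_mul, h2, monomial_eq, Polynomial.C_mul, Finsupp.prod, Finsupp.prod, map_prod]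
  simp only [map_pow]
  rw [show algebraMap k (Polynomial (MvPolynomial σ k)) c = Polynomial.C (C c) from rfl]
  ring

theorem coeff_coeff_weightHom (W : Finset σ) (f : MvPolynomial σ k) (m : σ →₀ ℕ) (d : ℕ) :
    coeff m ((weightHom k W f).coeff d) = if d = ∑ v ∈ W, m v then coeff m f else 0 := by
  classical
  induction f using MvPolynomial.induction_on' with
  | monomial u a =>
    rw [weightHom_monomial, Polynomial.coeff_X_pow_mul', coeff_monomial]
    by_cases h : u = m
    · subst h
      by_cases hd : d = ∑ v ∈ W, u v
      · subst hd; simp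
      · rw [if_neg hd]
        split_ifs with h2
        · rw [Polynomial.coeff_C, if_neg (by omega), coeff_zero]
        · rfl
    · simp only [if_neg h, ite_self]
      split_ifs with h2
      · rw [Polynomial.coeff_C]
        split_ifs
        · rw [coeff_monomial, if_neg h]
        · rfl
      · rfl
  | add p q hp hq =>
    rw [map_add, Polynomial.coeff_add, coeff_add, hp, hq, coeff_add]
    split_ifs <;> simp

/-- Expressing a weight bound as divisibility by a power of the prime `T` makes it possible to
cancel factors of weight zero. -/
theorem X_pow_dvd_weightHom_iff (W : Finset σ) (f : MvPolynomial σ k) (t : ℕ) :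
    Polynomial.X ^ t ∣ weightHom k W f ↔ ∀ m ∈ f.support, t ≤ ∑ v ∈ W, m v := by
  rw [Polynomial.X_pow_dvd_iff]
  constructor
  · intro h m hm
    by_contra! hlt
    have := coeff_coeff_weightHom W f m (∑ v ∈ W, m v)
    rw [h _ hlt, if_pos rfl, coeff_zero] at this
    exact (mem_support_iff.1 hm) this.symm
  · intro h d hd
    ext m
    rw [coeff_coeff_weightHom, coeff_zero]
    split_ifs with h1
    · by_contra hne
      have := h m (mem_support_iff.2 hne)
      omega
    · rfl

/-- The prime ideal of polynomials all of whose monomials involve a variable from `W`. -/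
noncomputable def variableIdeal (k : Type*) [Field k] (W : Finset σ) :
    Ideal (MvPolynomial σ k) :=
  (Ideal.span {Polynomial.X}).comap (weightHom k W)

theorem mem_variableIdeal {W : Finset σ} {f : MvPolynomial σ k} :
    f ∈ variableIdeal k W ↔ ∀ m ∈ f.support, 1 ≤ ∑ v ∈ W, m v := by
  rw [variableIdeal, Ideal.mem_comap, Ideal.mem_span_singleton, ← X_pow_dvd_weightHom_iff, pow_one]

theorem isPrime_variableIdeal (W : Finset σ) : (variableIdeal k W).IsPrime := by
  have : (Ideal.span {(Polynomial.X : Polynomial (MvPolynomial σ k))}).IsPrime :=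
    (Ideal.span_singleton_prime Polynomial.X_ne_zero).2 Polynomial.prime_X
  exact Ideal.comap_isPrime _ _

end MvPolynomial

open MvPolynomial

/-! ### Minimal vertex covers and symbolic powers of edge ideals -/

/-- `W` is a minimal vertex cover of `G`. -/
def IsMinimalVertexCover {V : Type*} (G : SimpleGraph V) (W : Finset V) : Prop :=
  (∀ i j, G.Adj i j → i ∈ W ∨ j ∈ W) ∧ ∀ i ∈ W, ∃ j, G.Adj i j ∧ j ∉ W

/-- A vertex of the cover whose neighbours all belong to the cover can be dropped. -/
theorem exists_isMinimalVertexCover_subset {V : Type*} [DecidableEq V] (G : SimpleGraph V)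
    (W : Finset V) (hW : ∀ i j, G.Adj i j → i ∈ W ∨ j ∈ W) :
    ∃ W' ⊆ W, IsMinimalVertexCover G W' := by
  induction W using Finset.strongInduction with
  | H W ih =>
    by_cases h : ∀ i ∈ W, ∃ j, G.Adj i j ∧ j ∉ W
    · exact ⟨W, subset_rfl, hW, h⟩
    · push Not at h
      obtain ⟨i, hi, hij⟩ := h
      obtain ⟨W', hW', hmin⟩ := ih (W.erase i) (Finset.erase_ssubset hi) (by
        intro a b hab
        simp only [Finset.mem_erase]
        by_cases ha : a = i
        · subst ha; exact Or.inr ⟨hab.ne', hij b hab⟩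
        · by_cases hb : b = i
          · subst hb; exact Or.inl ⟨ha, hij a hab.symm⟩
          · rcases hW a b hab with h | h
            · exact Or.inl ⟨ha, h⟩
            · exact Or.inr ⟨hb, h⟩)
      exact ⟨W', hW'.trans (Finset.erase_subset _ _), hmin⟩

section EdgeIdeal

variable {k V : Type*} [Field k] {G : SimpleGraph V}

theorem mem_edgeIdeal {f : MvPolynomial V k} :
    f ∈ edgeIdeal k G ↔ ∀ m ∈ f.support, ∃ i j, G.Adj i j ∧ m i ≠ 0 ∧ m j ≠ 0 := by
  classical
  have h : edgeMonomials k G = (fun s => monomial s (1 : k)) ''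
      {s | ∃ i j, G.Adj i j ∧ s = Finsupp.single i 1 + Finsupp.single j 1} := by
    ext f
    constructor
    · rintro ⟨i, j, hij, rfl⟩
      exact ⟨_, ⟨i, j, hij, rfl⟩, by simp [X, monomial_mul]⟩
    · rintro ⟨_, ⟨i, j, hij, rfl⟩, rfl⟩
      exact ⟨i, j, hij, by simp [X, monomial_mul]⟩
  rw [edgeIdeal, h, mem_ideal_span_monomial_image]
  refine forall₂_congr fun m _ => ⟨?_, ?_⟩
  · rintro ⟨_, ⟨i, j, hij, rfl⟩, hle⟩
    refine ⟨i, j, hij, ?_, ?_⟩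
    · have := hle i; simp at this; omega
    · have := hle j; simp at this; omega
  · rintro ⟨i, j, hij, hi, hj⟩
    refine ⟨_, ⟨i, j, hij, rfl⟩, fun v => ?_⟩
    simp only [Finsupp.add_apply, Finsupp.single_apply]
    have := hij.ne
    split_ifs <;> grind

theorem X_mul_X_mem_edgeIdeal {i j : V} (h : G.Adj i j) :
    (X i * X j : MvPolynomial V k) ∈ edgeIdeal k G :=
  Ideal.subset_span ⟨i, j, h, rfl⟩

theorem mem_colon_mk_iff {R : Type*} [CommRing R] (I : Ideal R) (f r : R) :
    r ∈ (⊥ : Submodule R (R ⧸ I)).colon {Ideal.Quotient.mk I f} ↔ r * f ∈ I := by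
  rw [Submodule.mem_colon_singleton, Submodule.mem_bot, ← Ideal.Quotient.eq_zero_iff_mem, map_mul]
  rfl

variable [DecidableEq V]

/-- The case `r = 1` serves vertex covers; `r = 2` with all vertices in `W` bounds the degree. -/
theorem X_pow_mul_dvd_weightHom_of_mem_edgeIdeal_pow {W : Finset V} {r : ℕ}
    (hW : ∀ i j, G.Adj i j → Polynomial.X ^ r ∣ weightHom k W (X i * X j)) {t : ℕ}
    {f : MvPolynomial V k} (hf : f ∈ edgeIdeal k G ^ t) :
    Polynomial.X ^ (r * t) ∣ weightHom k W f := by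
  have h1 : edgeIdeal k G ≤ (Ideal.span {Polynomial.X ^ r}).comap (weightHom k W) := by
    refine Ideal.span_le.2 ?_
    rintro _ ⟨i, j, hij, rfl⟩
    rw [SetLike.mem_coe, Ideal.mem_comap, Ideal.mem_span_singleton]
    exact hW i j hij
  have h2 := (Ideal.pow_right_mono h1 t).trans (Ideal.le_comap_pow (weightHom k W) t) hf
  rwa [Ideal.mem_comap, Ideal.span_singleton_pow, Ideal.mem_span_singleton, ← pow_mul] at h2

theorem X_pow_dvd_weightHom_of_mem_edgeIdeal_pow {W : Finset V}
    (hW : ∀ i j, G.Adj i j → i ∈ W ∨ j ∈ W) {t : ℕ} {f : MvPolynomial V k}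
    (hf : f ∈ edgeIdeal k G ^ t) : Polynomial.X ^ t ∣ weightHom k W f := by
  rw [← one_mul t]
  refine X_pow_mul_dvd_weightHom_of_mem_edgeIdeal_pow (fun i j hij => ?_) hf
  rw [map_mul, pow_one]
  rcases hW i j hij with h | h
  · exact Dvd.dvd.mul_right (by simp [weightHom, h]) _
  · exact Dvd.dvd.mul_left (by simp [weightHom, h]) _

variable [Fintype V]

/-- The prime is the annihilator of the product of the variables outside `W`: minimality gives each
`i ∈ W` a neighbour dividing that product. -/
theorem variableIdeal_mem_associatedPrimes {W : Finset V} (hW : IsMinimalVertexCover G W) :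
    variableIdeal k W ∈
      associatedPrimes (MvPolynomial V k) (MvPolynomial V k ⧸ edgeIdeal k G) := by
  refine isAssociatedPrime_iff.2 ?_
  refine ⟨isPrime_variableIdeal W, Ideal.Quotient.mk _
    (monomial (Finsupp.equivFunOnFinite.symm fun v => if v ∈ W then 0 else 1) 1), ?_⟩
  ext f
  rw [mem_colon_mk_iff, mem_variableIdeal, mem_edgeIdeal]
  set u : V →₀ ℕ := Finsupp.equivFunOnFinite.symm fun v => if v ∈ W then 0 else 1 with hu
  have huv : ∀ v, u v = if v ∈ W then 0 else 1 := fun v => rfl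
  constructor
  · intro h m hm
    rw [mem_support_iff, coeff_mul_monomial'] at hm
    split_ifs at hm with hle
    · rw [mul_one] at hm
      have h1 := h _ (mem_support_iff.2 hm)
      obtain ⟨i, hi, hi'⟩ := Finset.exists_ne_zero_of_sum_ne_zero (Nat.one_le_iff_ne_zero.1 h1)
      obtain ⟨j, hij, hj⟩ := hW.2 i hi
      refine ⟨i, j, hij, ?_, ?_⟩
      · rw [Finsupp.tsub_apply] at hi'; omega
      · have := hle j
        rw [huv, if_neg hj] at this; omega
    · exact absurd rfl hm
  · intro h m hm
    obtain ⟨i, j, hij, hi, hj⟩ := h (m + u) (by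
      rw [mem_support_iff, coeff_mul_monomial, mul_one]; exact mem_support_iff.1 hm)
    rw [Finsupp.add_apply, huv] at hi hj
    rcases hW.1 i j hij with h' | h'
    · rw [if_pos h'] at hi
      exact (Nat.one_le_iff_ne_zero.2 hi).trans
        (Finset.single_le_sum (f := fun v => m v) (fun _ _ => Nat.zero_le _) h')
    · rw [if_pos h'] at hj
      exact (Nat.one_le_iff_ne_zero.2 hj).trans
        (Finset.single_le_sum (f := fun v => m v) (fun _ _ => Nat.zero_le _) h')

-- Write `P = (I : f)` and pick a monomial `m` of `f` outside `I`; its support is independent. If `X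
-- i ∈ P`, then `X i * m` contains an edge, which must join `i` to the support of `m`. That
-- neighbour is not in `P`, whence minimality.
open Classical in
theorem isMinimalVertexCover_of_mem_associatedPrimes {P : Ideal (MvPolynomial V k)}
    (hP : P ∈ associatedPrimes (MvPolynomial V k) (MvPolynomial V k ⧸ edgeIdeal k G)) :
    IsMinimalVertexCover G (Finset.univ.filter fun i => X i ∈ P) := by
  obtain ⟨hprime, x, hx⟩ := isAssociatedPrime_iff.1 hP
  obtain ⟨f, rfl⟩ := Ideal.Quotient.mk_surjective x
  have hmem : ∀ r, r ∈ P ↔ r * f ∈ edgeIdeal k G := fun r => by rw [hx, mem_colon_mk_iff]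
  have hf : f ∉ edgeIdeal k G := fun h =>
    hprime.ne_top ((Ideal.eq_top_iff_one _).2 ((hmem 1).2 (by rwa [one_mul])))
  rw [mem_edgeIdeal] at hf
  push Not at hf
  obtain ⟨m, hm, hno⟩ := hf
  have key : ∀ i, X i ∈ P → m i = 0 ∧ ∃ j, G.Adj i j ∧ m j ≠ 0 := by
    intro i hi
    rw [hmem, mem_edgeIdeal] at hi
    obtain ⟨a, b, hab, ha, hb⟩ := hi (Finsupp.single i 1 + m) (by
      rw [mem_support_iff, coeff_X_mul]; exact mem_support_iff.1 hm)
    simp only [Finsupp.add_apply, Finsupp.single_apply] at ha hb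
    have h1 := hno a b hab
    have h2 := hab.ne
    by_cases hia : i = a
    · subst hia
      rw [if_neg h2] at hb
      simp only [zero_add] at hb
      exact ⟨by by_contra h3; exact hb (h1 h3), b, hab, hb⟩
    · rw [if_neg hia, zero_add] at ha
      by_cases hib : i = b
      · subst hib
        exact ⟨h1 ha, a, hab.symm, ha⟩
      · rw [if_neg hib, zero_add] at hb
        exact absurd (h1 ha) hb
  constructor
  · intro i j hij
    simp only [Finset.mem_filter, Finset.mem_univ, true_and]
    exact hprime.mem_or_mem ((hmem _).2 (Ideal.mul_mem_right _ _ (X_mul_X_mem_edgeIdeal hij)))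
  · intro i hi
    obtain ⟨-, j, hij, hj⟩ := key i (Finset.mem_filter.1 hi).2
    exact ⟨j, hij, fun h => hj (key j (Finset.mem_filter.1 h).2).1⟩

theorem mem_symbolicPower_edgeIdeal {t : ℕ} {f : MvPolynomial V k} :
    f ∈ symbolicPower (edgeIdeal k G) t ↔
      ∀ m ∈ f.support, ∀ W, IsMinimalVertexCover G W → t ≤ ∑ v ∈ W, m v := by
  classical
  simp only [symbolicPower, Submodule.mem_iInf, Ideal.mem_comap]
  constructor
  · intro h m hm W hW
    revert m
    rw [← X_pow_dvd_weightHom_iff]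
    have hass := variableIdeal_mem_associatedPrimes (k := k) hW
    have h1 := h _ hass
    have := hass.isPrime
    rw [IsLocalization.algebraMap_mem_map_algebraMap_iff (variableIdeal k W).primeCompl] at h1
    obtain ⟨s, hs, hsf⟩ := h1
    have h2 := X_pow_dvd_weightHom_of_mem_edgeIdeal_pow hW.1 hsf
    rw [map_mul] at h2
    -- The denominator `s` avoids the prime, so `T` does not divide its image and can be cancelled.
    refine (Polynomial.prime_X).pow_dvd_of_dvd_mul_left _ (fun h3 => hs ?_) h2
    exact Ideal.mem_span_singleton.2 h3
  · intro h P hP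
    have := hP.isPrime
    have hmin := isMinimalVertexCover_of_mem_associatedPrimes hP
    set W := Finset.univ.filter fun i => (X i : MvPolynomial V k) ∈ P 
    set J := (edgeIdeal k G).map (algebraMap (MvPolynomial V k) (Localization.AtPrime P)) with hJ
    -- A neighbour `j` outside `W` gives a unit `X j` in the local ring, so `X i` itself lies in the
    -- extended ideal.
    have hX : ∀ i ∈ W, algebraMap (MvPolynomial V k) (Localization.AtPrime P) (X i) ∈ J := by
      intro i hi
      obtain ⟨j, hij, hj⟩ := hmin.2 i hi
      rw [hJ, IsLocalization.algebraMap_mem_map_algebraMap_iff P.primeCompl]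
      exact ⟨X j, fun hj' => hj (Finset.mem_filter.2 ⟨Finset.mem_univ _, hj'⟩),
        X_mul_X_mem_edgeIdeal hij.symm⟩
    rw [Ideal.map_pow, ← hJ, f.as_sum, map_sum]
    refine Ideal.sum_mem _ fun m hm => ?_
    have hw := h m hm W hmin
    rw [monomial_eq, map_mul, Finsupp.prod_fintype _ _ (fun _ => pow_zero _),
      ← Finset.prod_mul_prod_compl W, map_mul]
    refine Ideal.mul_mem_left _ _ (Ideal.mul_mem_right _ _ (Ideal.pow_le_pow_right hw ?_))
    rw [map_prod, ← Finset.prod_pow_eq_pow_sum]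
    refine Ideal.prod_mem_prod fun i hi => ?_
    rw [map_pow]
    exact Ideal.pow_mem_pow (hX i hi) _

theorem two_mul_le_degree_of_mem_edgeIdeal_pow {t : ℕ} {f : MvPolynomial V k}
    (hf : f ∈ edgeIdeal k G ^ t) : ∀ m ∈ f.support, 2 * t ≤ m.degree := by
  intro m hm
  rw [Finsupp.degree_eq_sum]
  refine (X_pow_dvd_weightHom_iff Finset.univ f (2 * t)).1
    (X_pow_mul_dvd_weightHom_of_mem_edgeIdeal_pow (fun i j _ => ?_) hf) m hm
  rw [map_mul, sq]
  exact mul_dvd_mul (by simp [weightHom]) (by simp [weightHom])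

theorem edgeIdeal_pow_le_symbolicPower (t : ℕ) :
    edgeIdeal k G ^ t ≤ symbolicPower (edgeIdeal k G) t := by
  intro f hf
  rw [mem_symbolicPower_edgeIdeal]
  intro m hm W hW
  exact (X_pow_dvd_weightHom_iff W f t).1 (X_pow_dvd_weightHom_of_mem_edgeIdeal_pow hW.1 hf) m hm

end EdgeIdeal

/-! ### Minimal generators of a quotient, by degree -/

theorem le_degree_of_mem_sup_span_monomial {σ k : Type*} [Field k]
    {J : Ideal (MvPolynomial σ k)} {S : Finset (σ →₀ ℕ)} {d : ℕ} (hS : ∀ m ∈ S, m.degree = d)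
    (hJ : ∀ f ∈ J, ∀ m ∈ f.support, d < m.degree) {f : MvPolynomial σ k}
    (hf : f ∈ J ⊔ Ideal.span ((fun m => monomial m (1 : k)) '' (S : Set (σ →₀ ℕ)))) :
    ∀ m ∈ f.support, d ≤ m.degree := by
  classical
  obtain ⟨a, ha, b, hb, rfl⟩ := Submodule.mem_sup.1 hf
  intro m hm
  rcases Finset.mem_union.1 (support_add hm) with h | h
  · exact (hJ a ha m h).le
  · obtain ⟨s, hs, hle⟩ := mem_ideal_span_monomial_image.1 hb m h
    rw [← hS s hs]
    exact Finsupp.degree_mono hle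

/-- In the lowest degree, multiplication by `r` acts through its constant term. This makes taking
coefficients semilinear over `constantCoeff`. -/
theorem coeff_mul_of_degree_le {σ k : Type*} [Field k] {d : ℕ} {r f : MvPolynomial σ k}
    (hf : ∀ m ∈ f.support, d ≤ m.degree) {m : σ →₀ ℕ} (hm : m.degree = d) :
    coeff m (r * f) = constantCoeff r * coeff m f := by
  classical
  rw [coeff_mul, Finset.sum_eq_single (0, m)]
  · rfl
  · rintro ⟨a, b⟩ hab hne
    rw [Finset.HasAntidiagonal.mem_antidiagonal] at hab
    simp only at hab ⊢
    by_cases hb : coeff b f = 0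
    · rw [hb, mul_zero]
    · exfalso
      have h1 := hf b (mem_support_iff.2 hb)
      have h2 : a.degree + b.degree = d := by rw [← hm, ← hab, map_add]
      have h3 : a = 0 := (Finsupp.degree_eq_zero_iff a).1 (by omega)
      subst h3
      exact hne (by rw [← hab, zero_add])
  · intro h
    exact absurd (Finset.HasAntidiagonal.mem_antidiagonal.2 (zero_add m)) h

/-- If `K` is generated over `J` by monomials of degree `d`, and `J` lives in degrees `> d`, then
these monomials form a minimal system of generators of `K / J`. -/
theorem spanFinrank_quotient_eq_card {σ k : Type*} [Field k] {J K : Ideal (MvPolynomial σ k)}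
    {S : Finset (σ →₀ ℕ)} {d : ℕ} (hS : ∀ m ∈ S, m.degree = d)
    (hJ : ∀ f ∈ J, ∀ m ∈ f.support, d < m.degree)
    (hK : K = J ⊔ Ideal.span ((fun m => monomial m (1 : k)) '' (S : Set (σ →₀ ℕ)))) :
    (⊤ : Submodule (MvPolynomial σ k) (↥K ⧸ Submodule.submoduleOf J K)).spanFinrank = S.card := by
  classical
  have hdeg : ∀ f ∈ K, ∀ m ∈ f.support, d ≤ m.degree := fun f hf =>
    le_degree_of_mem_sup_span_monomial hS hJ (hK ▸ hf)
  have hSK : ∀ m ∈ S, monomial m (1 : k) ∈ K := fun m hm =>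
    hK ▸ Ideal.mem_sup_right (Ideal.subset_span ⟨m, hm, rfl⟩)
  set g : S → ↥K ⧸ Submodule.submoduleOf J K :=
    fun m => Submodule.Quotient.mk ⟨monomial m.1 1, hSK m.1 m.2⟩ with hg
  have hspan : Submodule.span (MvPolynomial σ k) (Set.range g) = ⊤ := by
    rw [eq_top_iff]
    rintro x -
    obtain ⟨⟨f, hf⟩, rfl⟩ := Submodule.Quotient.mk_surjective _ x
    have h1 := hf
    rw [hK] at h1
    obtain ⟨a, ha, b, hb, rfl⟩ := Submodule.mem_sup.1 h1
    have haK : a ∈ K := hK ▸ Ideal.mem_sup_left ha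
    have key : ∀ b (_ : b ∈ Ideal.span ((fun m => monomial m (1 : k)) '' (S : Set (σ →₀ ℕ)))),
        ∀ hbK : b ∈ K, (Submodule.Quotient.mk ⟨b, hbK⟩ : ↥K ⧸ Submodule.submoduleOf J K) ∈
          Submodule.span (MvPolynomial σ k) (Set.range g) := by
      intro b hb
      refine Submodule.span_induction (p := fun b _ => ∀ hbK : b ∈ K,
        (Submodule.Quotient.mk ⟨b, hbK⟩ : ↥K ⧸ Submodule.submoduleOf J K) ∈
          Submodule.span (MvPolynomial σ k) (Set.range g)) ?_ ?_ ?_ ?_ hb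
      · rintro _ ⟨m, hm, rfl⟩ hmK
        exact Submodule.subset_span ⟨⟨m, hm⟩, rfl⟩
      · intro h0
        exact Submodule.zero_mem _
      · intro x y hx hy ihx ihy hxy
        have hxK : x ∈ K := hK ▸ Ideal.mem_sup_right hx
        have hyK : y ∈ K := hK ▸ Ideal.mem_sup_right hy
        exact Submodule.add_mem _ (ihx hxK) (ihy hyK)
      · intro r x hx ihx hrx
        have hxK : x ∈ K := hK ▸ Ideal.mem_sup_right hx
        exact Submodule.smul_mem _ r (ihx hxK)
    have hbK : b ∈ K := hK ▸ Ideal.mem_sup_right hb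
    have h2 : (Submodule.Quotient.mk ⟨a + b, hf⟩ : ↥K ⧸ Submodule.submoduleOf J K) =
        Submodule.Quotient.mk ⟨b, hbK⟩ := by
      rw [Submodule.Quotient.eq]
      change a + b - b ∈ J
      rwa [add_sub_cancel_right]
    rw [h2]
    exact key b hb hbK
  apply le_antisymm
  · rw [← hspan]
    refine (Submodule.spanFinrank_span_le_ncard_of_finite (Set.finite_range g)).trans ?_
    rw [← Set.image_univ]
    refine (Set.ncard_image_le Set.finite_univ).trans ?_
    rw [Set.ncard_univ, Nat.card_eq_fintype_card, Fintype.card_coe]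
  -- Lower bound: the coefficients at `S` kill `J` and map the quotient onto `S → k`, which needs
  -- `S.card` generators.
  · let φ : ↥K →ₛₗ[(constantCoeff : MvPolynomial σ k →+* k)] (S → k) :=
      { toFun := fun f m => coeff m.1 f.1
        map_add' := fun f g => by ext m; simp
        map_smul' := fun r f => by
          ext m
          exact coeff_mul_of_degree_le (hdeg f.1 f.2) (hS m.1 m.2) }
    let ψ := (Submodule.submoduleOf J K).liftQ φ (by
      rintro ⟨f, hf⟩ hfJ
      rw [LinearMap.mem_ker]
      ext m
      change coeff m.1 f = 0
      by_contra hne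
      have := hJ f hfJ m.1 (mem_support_iff.2 hne)
      rw [hS m.1 m.2] at this
      exact lt_irrefl _ this)
    have hsurj : RingHomSurjective (constantCoeff : MvPolynomial σ k →+* k) :=
      ⟨fun c => ⟨C c, constantCoeff_C σ c⟩⟩
    have hfg : (⊤ : Submodule (MvPolynomial σ k) (↥K ⧸ Submodule.submoduleOf J K)).FG :=
      ⟨Finset.univ.image g, by simpa using hspan⟩
    have hmap : Submodule.map ψ ⊤ = ⊤ := by
      rw [eq_top_iff, ← (Pi.basisFun k S).span_eq, Submodule.span_le]
      rintro _ ⟨m, rfl⟩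
      refine ⟨g m, trivial, ?_⟩
      ext m'
      change coeff m'.1 (monomial m.1 (1 : k)) = _
      rw [coeff_monomial, Pi.basisFun_apply, Pi.single_apply]
      simp only [Subtype.ext_iff, eq_comm]
    have h1 := Submodule.spanFinrank_map_le_of_fg ψ hfg
    rw [hmap] at h1
    refine le_trans (le_of_eq ?_) h1
    rw [← Module.finrank_eq_spanFinrank_of_free, Module.finrank_fintype_fun_eq_card,
      Fintype.card_coe]

/-! ### The counting identity -/

/-- Vandermonde for `(N + (s - 1)).choose s`. Combinatorially, `l` is the number of distinct
elements of a multiset of size `s`. -/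
theorem choose_mul_intMultichoose_sum (N s : ℕ) (hs : 1 ≤ s) (hN : s ≤ N) :
    ∑ l ∈ Finset.Icc 1 N, N.choose l * intMultichoose l ((s : ℤ) - (l : ℤ)) = N.multichoose s := by
  have h1 : ∀ l ∈ Finset.Icc 1 N, N.choose l * intMultichoose l ((s : ℤ) - (l : ℤ)) =
      if l ≤ s then N.choose l * (s - 1).choose (s - l) else 0 := by
    intro l hl
    rw [Finset.mem_Icc] at hl
    unfold intMultichoose
    by_cases h : l ≤ s
    · rw [if_pos (by omega), if_pos h, show ((s : ℤ) - (l : ℤ)).toNat = s - l by omega,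
        Nat.multichoose_eq, show l + (s - l) - 1 = s - 1 by omega]
    · rw [if_neg (by omega), if_neg h, mul_zero]
  rw [Finset.sum_congr rfl h1, Nat.multichoose_eq, show N + s - 1 = N + (s - 1) by omega,
    Nat.add_choose_eq, Finset.Nat.sum_antidiagonal_eq_sum_range_succ_mk, ← Finset.sum_filter]
  have h2 : (Finset.Icc 1 N).filter (· ≤ s) = Finset.Icc 1 s := by
    ext l; simp only [Finset.mem_filter, Finset.mem_Icc]; omega
  rw [h2, Finset.sum_range_succ', Nat.sub_zero, Nat.choose_eq_zero_of_lt (by omega : s - 1 < s),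
    mul_zero, add_zero, Finset.range_eq_Ico, Finset.sum_Ico_add' (fun l => N.choose l * (s - 1).choose (s - l)) 0 s 1]
  rfl

/-! ### Weighted matchings on paths and cycles -/

section WeightedMatchings

open Finset

/-- König's theorem for a weighted path on the vertices `0, …, m - 1`; here `y j` is the
multiplicity of the edge `{j - 1, j}`. -/
theorem exists_path_matching (m t : ℕ) (b : ℕ → ℕ)
    (h : ∀ c : ℕ → ℕ, (∀ j, c j ≤ 1) → (∀ j, j + 1 < m → 1 ≤ c j + c (j + 1)) →
      t ≤ ∑ j ∈ range m, c j * b j) :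
    ∃ y : ℕ → ℕ, y 0 = 0 ∧ y m = 0 ∧ (∀ j < m, y j + y (j + 1) ≤ b j) ∧
      t ≤ ∑ j ∈ range m, y j := by
  induction m generalizing t b with
  | zero => exact ⟨0, rfl, rfl, by simp, by simpa using h 0 (by simp) (by simp)⟩
  | succ m ih =>
    rcases m with _ | m
    · exact ⟨0, rfl, rfl, by simp, by simpa using h 0 (by simp) (by simp)⟩
    -- Greedy choice: the last edge is used as often as possible, and the rest is done on the path
    -- shortened by one vertex.
    · set e := min (b m) (b (m + 1)) with he
      have he1 : e ≤ b m := min_le_left _ _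
      have he2 : e ≤ b (m + 1) := min_le_right _ _
      obtain ⟨y, hy0, hym, hy, hsum⟩ := ih (t - e) (fun j => if j = m then b m - e else b j) (by
        intro c hc1 hc
        have hlow : ∑ j ∈ range m, c j * (if j = m then b m - e else b j) =
            ∑ j ∈ range m, c j * b j :=
          sum_congr rfl fun j hj => by rw [if_neg (mem_range.1 hj).ne]
        rw [sum_range_succ, hlow, if_pos rfl]
        have hcongr : ∀ p q, ∑ j ∈ range m, (if j = m then p else if j = m + 1 then q else c j) * b j
            = ∑ j ∈ range m, c j * b j := fun p q =>
          sum_congr rfl fun j hj => by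
            have := mem_range.1 hj
            rw [if_neg (by omega), if_neg (by omega)]
        have hgen : ∀ p q, p ≤ 1 → q ≤ 1 → 1 ≤ p + q → c m ≤ p →
            t ≤ ∑ j ∈ range m, c j * b j + p * b m + q * b (m + 1) := by
          intro p q hp hq hpq hcp
          have := h (fun j => if j = m then p else if j = m + 1 then q else c j)
            (fun j => by have := hc1 j; split_ifs <;> assumption)
            (fun j hj => by
              rcases lt_trichotomy (j + 1) m with h1 | h1 | h1
              · have := hc j (by omega)
                rw [if_neg (by omega), if_neg (by omega), if_neg (by omega), if_neg (by omega)]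
                exact this
              · have := hc j (by omega)
                rw [if_neg (by omega), if_neg (by omega), if_pos h1]
                rw [h1] at this
                omega
              · have : j = m := by omega
                rw [if_pos this, if_neg (by omega), if_pos (by omega)]
                exact hpq)
          rw [sum_range_succ, sum_range_succ, hcongr] at this
          simpa using this
        have hcm := hc1 m
        -- If `c` omits `m`, adding the lighter of the last two vertices costs exactly `e`; if it
        -- contains `m`, it already covers the last edge.
        rcases Nat.lt_or_ge (c m) 1 with h0 | h0
        · have h0' : c m = 0 := by omega
          rw [h0', zero_mul]
          rcases le_total (b (m + 1)) (b m) with hb | hb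
          · have := hgen 0 1 (by simp) le_rfl (by simp) (by omega)
            rw [min_eq_right hb] at he
            omega
          · have := hgen 1 0 le_rfl (by simp) (by simp) (by omega)
            rw [min_eq_left hb] at he
            omega
        · have h0' : c m = 1 := by omega
          have := hgen 1 0 le_rfl (by simp) (by simp) (by omega)
          rw [h0']
          omega)
      refine ⟨fun j => if j < m + 1 then y j else if j = m + 1 then e else 0, ?_, ?_, ?_, ?_⟩
      · simpa using hy0
      · simp
      · intro j hj
        dsimp only
        rcases lt_trichotomy j m with h1 | h1 | h1
        · have := hy j (by omega)
          rw [if_neg h1.ne] at this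
          rw [if_pos (by omega), if_pos (by omega)]
          exact this
        · subst h1
          have := hy j (by omega)
          rw [if_pos rfl] at this
          rw [if_pos (by omega), if_neg (by omega), if_pos rfl]
          omega
        · obtain rfl : j = m + 1 := by omega
          rw [if_neg (by omega), if_pos rfl, if_neg (by omega), if_neg (by omega)]
          exact he2
      · rw [sum_range_succ, if_neg (by omega), if_pos rfl]
        have : ∑ j ∈ range (m + 1), (if j < m + 1 then y j else if j = m + 1 then e else 0) =
            ∑ j ∈ range (m + 1), y j :=
          sum_congr rfl fun j hj => if_pos (mem_range.1 hj)
        rw [this]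
        omega

/-- Two covers of a path that contain opposite end points only are together at least as heavy as
two covers of the cycle obtained by adding the vertex `m`, or as the whole cycle. -/
theorem two_mul_le_add_of_covers {m t : ℕ} (a : ℕ → ℕ)
    (h : ∀ c : ℕ → ℕ, (∀ j, c j ≤ 1) → (∀ j < m, 1 ≤ c j + c (j + 1)) → 1 ≤ c m + c 0 →
      t ≤ ∑ j ∈ range (m + 1), c j * a j)
    (htot : 2 * t ≤ ∑ j ∈ range (m + 1), a j) {c₁ c₂ : ℕ → ℕ}
    (h₁ : ∀ j, c₁ j ≤ 1) (h₂ : ∀ j, c₂ j ≤ 1)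
    (hc₁ : ∀ j, j + 1 < m → 1 ≤ c₁ j + c₁ (j + 1)) (hc₂ : ∀ j, j + 1 < m → 1 ≤ c₂ j + c₂ (j + 1))
    (h₁0 : c₁ 0 = 1) (h₁m : c₁ (m - 1) = 0) (h₂m : c₂ (m - 1) = 1) :
    2 * t ≤ ∑ j ∈ range m, c₁ j * a j + ∑ j ∈ range m, c₂ j * a j + a m := by
  rw [← sum_add_distrib]
  -- Where the covers agree they can exchange tails: one result contains both end points and covers
  -- the cycle without vertex `m`, the other does so with `m` added.
  by_cases hv : ∃ v < m, c₁ v = c₂ v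
  · obtain ⟨v, hvm, hv⟩ := hv
    have hv1 : v ≠ m - 1 := by rintro rfl; omega
    have aux : ∀ c d : ℕ → ℕ, (∀ j, c j ≤ 1) → (∀ j, d j ≤ 1) →
        (∀ j, j + 1 < m → 1 ≤ c j + c (j + 1)) → (∀ j, j + 1 < m → 1 ≤ d j + d (j + 1)) →
        c v = d v → ∀ e, e ≤ 1 → (e = 1 ∨ c 0 = 1 ∧ d (m - 1) = 1) →
        t ≤ ∑ j ∈ range m, (if j ≤ v then c j else d j) * a j + e * a m := by
      intro c d hc hd hcc hdd hcd e he hor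
      have := h (fun j => if j = m then e else if j ≤ v then c j else d j)
        (fun j => by
          have := hc j; have := hd j
          split_ifs <;> assumption)
        (fun j hj => by
          rw [if_neg hj.ne]
          by_cases hjm : j + 1 = m
          · rw [if_pos hjm, if_neg (by omega)]
            obtain rfl : j = m - 1 := by omega
            omega
          · rw [if_neg hjm]
            have h1 := hcc j (by omega)
            have h2 := hdd j (by omega)
            rcases lt_trichotomy j v with h3 | h3 | h3
            · rw [if_pos h3.le, if_pos (by omega)]; exact h1
            · subst h3
              rw [if_pos le_rfl, if_neg (by omega), hcd]; exact h2
            · rw [if_neg (by omega), if_neg (by omega)]; exact h2)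
        (by
          rw [if_pos rfl, if_neg (by omega), if_pos (Nat.zero_le _)]
          omega)
      rw [sum_range_succ, if_pos rfl] at this
      rwa [sum_congr rfl fun j hj => by rw [if_neg (mem_range.1 hj).ne]] at this
    have k1 := aux c₁ c₂ h₁ h₂ hc₁ hc₂ hv 0 (by simp) (Or.inr ⟨h₁0, h₂m⟩)
    have k2 := aux c₂ c₁ h₂ h₁ hc₂ hc₁ hv.symm 1 le_rfl (Or.inl rfl)
    have k3 : ∑ j ∈ range m, (c₁ j * a j + c₂ j * a j) =
        ∑ j ∈ range m, (if j ≤ v then c₁ j else c₂ j) * a j +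
        ∑ j ∈ range m, (if j ≤ v then c₂ j else c₁ j) * a j := by
      rw [← sum_add_distrib]
      refine sum_congr rfl fun j _ => ?_
      split_ifs
      · rfl
      · rw [add_comm]
    omega
  -- Covers that agree nowhere are complementary, so together with `m` they weigh the whole cycle.
  · push Not at hv
    rw [sum_range_succ] at htot
    refine htot.trans (Nat.add_le_add_right (sum_le_sum fun j hj => ?_) _)
    have e1 := hv j (mem_range.1 hj)
    have e2 := h₁ j
    have e3 := h₂ j
    rw [← add_mul, show c₁ j + c₂ j = 1 by omega, one_mul]

/-- A weighted cycle on the vertices `0, …, m` all of whose vertex covers weigh at least `t`, and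
whose total weight is at least `2 * t`, has a matching of size `t`; here `y j` is the multiplicity
of the edge `{j - 1, j}`. -/
theorem exists_cycle_matching (m t : ℕ) (hm : 2 ≤ m) (a : ℕ → ℕ)
    (ha0 : a m ≤ a 0) (ham : a m ≤ a (m - 1))
    (h : ∀ c : ℕ → ℕ, (∀ j, c j ≤ 1) → (∀ j < m, 1 ≤ c j + c (j + 1)) → 1 ≤ c m + c 0 →
      t ≤ ∑ j ∈ range (m + 1), c j * a j)
    (htot : 2 * t ≤ ∑ j ∈ range (m + 1), a j) :
    ∃ y : ℕ → ℕ, y (m + 1) = y 0 ∧ (∀ j ≤ m, y j + y (j + 1) ≤ a j) ∧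
      t ≤ ∑ j ∈ range (m + 1), y j := by
  set d := a m with hd
  -- Vertex `m` spends `p` on its edge to `m - 1` and `d - p` on its edge to `0`; `b p` is what
  -- remains on the path. Minimality of `a m` keeps the subtractions from truncating.
  set b : ℕ → ℕ → ℕ := fun p j =>
    if j = 0 then a 0 - (d - p) else if j = m - 1 then a (m - 1) - p else a j with hb
  by_cases hex : ∃ p ≤ d, ∀ c : ℕ → ℕ, (∀ j, c j ≤ 1) → (∀ j, j + 1 < m → 1 ≤ c j + c (j + 1)) →
      t - d ≤ ∑ j ∈ range m, c j * b p j
  · obtain ⟨p, hp, hcov⟩ := hex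
    obtain ⟨y, hy0, hym, hy, hsum⟩ := exists_path_matching m (t - d) (b p) hcov
    obtain ⟨Y, hY0, hYlt, hYm, hYm1⟩ : ∃ Y : ℕ → ℕ, Y 0 = d - p ∧
        (∀ j, j + 1 < m → Y (j + 1) = y (j + 1)) ∧ Y m = p ∧ Y (m + 1) = d - p := by
      refine ⟨fun j => if j = 0 then d - p else if j < m then y j else if j = m then p else d - p,
        by simp, fun j hj => by simp [hj], ?_, by simp⟩
      have : m ≠ 0 := by omega
      simp [this]
    obtain ⟨q, rfl⟩ : ∃ q, m = q + 2 := ⟨m - 2, by omega⟩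
    simp only [show q + 2 - 1 = q + 1 by omega] at *
    refine ⟨Y, by rw [hY0, hYm1], ?_, ?_⟩
    · intro j hj
      rcases Nat.eq_zero_or_pos j with rfl | hj0
      · have := hy 0 (by omega)
        simp only [hb, if_pos] at this
        rw [hY0, hYlt 0 (by omega)]
        omega
      · obtain ⟨j, rfl⟩ : ∃ i, j = i + 1 := ⟨j - 1, by omega⟩
        rcases lt_trichotomy j q with h1 | h1 | h1
        · have := hy (j + 1) (by omega)
          simp only [hb] at this
          rw [if_neg (by omega), if_neg (by omega)] at this
          rw [hYlt j (by omega), hYlt (j + 1) (by omega)]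
          exact this
        · subst h1
          have := hy (j + 1) (by omega)
          simp only [hb] at this
          rw [if_neg (by omega), if_pos trivial, hym] at this
          rw [hYlt j (by omega), hYm]
          omega
        · obtain rfl : j = q + 1 := by omega
          rw [hYm, hYm1, show a (q + 1 + 1) = d from rfl]
          omega
    · rw [sum_range_succ, sum_range_succ', hY0, hYm]
      rw [sum_range_succ', hy0] at hsum
      have : ∑ k ∈ range (q + 1), Y (k + 1) = ∑ k ∈ range (q + 1), y (k + 1) :=
        sum_congr rfl fun k hk => hYlt k (by have := mem_range.1 hk; omega)
      rw [this]
      omega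
  · exfalso
    push Not at hex
    have hwt : ∀ p ≤ d, ∀ c : ℕ → ℕ,
        ∑ j ∈ range m, c j * b p j + c 0 * (d - p) + c (m - 1) * p = ∑ j ∈ range m, c j * a j := by
      intro p hp c
      obtain ⟨q, rfl⟩ : ∃ q, m = q + 2 := ⟨m - 2, by omega⟩
      simp only [show q + 2 - 1 = q + 1 by omega] at *
      rw [sum_range_succ, sum_range_succ', sum_range_succ _ (q + 1),
        sum_range_succ' (fun j => c j * a j)]
      have e1 : ∑ k ∈ range q, c (k + 1) * b p (k + 1) = ∑ k ∈ range q, c (k + 1) * a (k + 1) :=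
        sum_congr rfl fun k hk => by
          have := mem_range.1 hk
          simp only [hb]
          rw [if_neg (by omega), if_neg (by omega)]
      have e2 : c 0 * b p 0 + c 0 * (d - p) = c 0 * a 0 := by
        rw [← mul_add]; congr 1; simp only [hb, if_pos]; omega
      have e3 : c (q + 1) * b p (q + 1) + c (q + 1) * p = c (q + 1) * a (q + 1) := by
        rw [← mul_add]; congr 1; simp only [hb]; rw [if_neg (by omega)]; simp; omega
      rw [e1]
      omega
    have hbig : ∀ c : ℕ → ℕ, (∀ j, c j ≤ 1) → (∀ j, j + 1 < m → 1 ≤ c j + c (j + 1)) →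
        ∀ e ≤ 1, (e = 1 ∨ c 0 = 1 ∧ c (m - 1) = 1) → t ≤ ∑ j ∈ range m, c j * a j + e * d := by
      intro c hc hcc e he hor
      have := h (fun j => if j = m then e else c j)
        (fun j => by have := hc j; split_ifs <;> assumption)
        (fun j hj => by
          rw [if_neg hj.ne]
          by_cases hjm : j + 1 = m
          · rw [if_pos hjm]
            obtain rfl : j = m - 1 := by omega
            omega
          · rw [if_neg hjm]; exact hcc j (by omega))
        (by rw [if_pos rfl, if_neg (by omega)]; omega)
      rw [sum_range_succ, if_pos rfl] at this
      rwa [sum_congr rfl fun j hj => by rw [if_neg (mem_range.1 hj).ne]] at this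
    -- A path cover violating the bound for `p` contains exactly one end point, since otherwise
    -- `hbig` applies. `R p` records a violation containing `0`, and `L p` one containing `m - 1`.
    let R : ℕ → Prop := fun p => ∃ c : ℕ → ℕ, (∀ j, c j ≤ 1) ∧
      (∀ j, j + 1 < m → 1 ≤ c j + c (j + 1)) ∧ c 0 = 1 ∧ c (m - 1) = 0 ∧
      ∑ j ∈ range m, c j * a j + p < t
    let L : ℕ → Prop := fun p => ∃ c : ℕ → ℕ, (∀ j, c j ≤ 1) ∧
      (∀ j, j + 1 < m → 1 ≤ c j + c (j + 1)) ∧ c (m - 1) = 1 ∧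
      ∑ j ∈ range m, c j * a j + d < t + p
    have hRL : ∀ p ≤ d, R p ∨ L p := by
      intro p hp
      obtain ⟨c, hc, hcc, hlt⟩ := hex p hp
      have h1 := hwt p hp c
      have hc0 := hc 0
      have hcm := hc (m - 1)
      rcases Nat.lt_or_ge (c (m - 1)) 1 with h2 | h2
      · have h2' : c (m - 1) = 0 := by omega
        rcases Nat.lt_or_ge (c 0) 1 with h3 | h3
        · have h3' : c 0 = 0 := by omega
          have := hbig c hc hcc 1 le_rfl (Or.inl rfl)
          rw [h2', h3'] at h1
          omega
        · have h3' : c 0 = 1 := by omega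
          rw [h2', h3'] at h1
          exact Or.inl ⟨c, hc, hcc, h3', h2', by omega⟩
      · have h2' : c (m - 1) = 1 := by omega
        rcases Nat.lt_or_ge (c 0) 1 with h3 | h3
        · have h3' : c 0 = 0 := by omega
          rw [h2', h3'] at h1
          exact Or.inr ⟨c, hc, hcc, h2', by omega⟩
        · have h3' : c 0 = 1 := by omega
          have := hbig c hc hcc 0 (by simp) (Or.inr ⟨h3', h2'⟩)
          rw [h2', h3'] at h1
          omega
    have hL0 : ¬ L 0 := by
      rintro ⟨c, hc, hcc, -, hlt⟩
      have := hbig c hc hcc 1 le_rfl (Or.inl rfl)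
      omega
    have hRd : ¬ R d := by
      rintro ⟨c, hc, hcc, -, -, hlt⟩
      have := hbig c hc hcc 1 le_rfl (Or.inl rfl)
      omega
    -- The weights of the two covers together with `d` would sum to at most `2t - 1`. Hence `R`
    -- propagates from `0` up to `d`, where it is impossible.
    have hstep : ∀ p, p < d → R p → ¬ L (p + 1) := by
      rintro p hp ⟨c₁, h₁, hc₁, h₁0, h₁m, hw₁⟩ ⟨c₂, h₂, hc₂, h₂m, hw₂⟩
      have := two_mul_le_add_of_covers a h htot h₁ h₂ hc₁ hc₂ h₁0 h₁m h₂m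
      omega
    have hR : ∀ p ≤ d, R p := by
      intro p
      induction p with
      | zero => intro hp; exact (hRL 0 hp).resolve_right hL0
      | succ p ih =>
        intro hp
        exact (hRL _ hp).resolve_right (hstep p (by omega) (ih (by omega)))
    exact hRd (hR d le_rfl)

end WeightedMatchings

/-! ### Matchings and alternating covers on `Fin N` -/

section CyclicMatchings

open Finset
open scoped Fin.NatCast Fin.CommRing

theorem sum_range_two_mul_add_one (f : ℕ → ℕ) (n : ℕ) :
    ∑ r ∈ range (2 * n + 1), f r =
      ∑ k ∈ range (n + 1), f (2 * k) + ∑ k ∈ range n, f (2 * k + 1) := by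
  induction n with
  | zero => simp
  | succ n ih =>
    rw [show 2 * (n + 1) + 1 = 2 * n + 1 + 1 + 1 by ring, sum_range_succ, sum_range_succ, ih,
      sum_range_succ _ (n + 1), sum_range_succ (fun k => f (2 * k + 1)),
      show 2 * (n + 1) = 2 * n + 1 + 1 by ring]
    ring

section Cycle

variable {N : ℕ} [NeZero N]

theorem Fin.sum_add_natCast (a : Fin N → ℕ) (i : Fin N) :
    ∑ r ∈ range N, a (i + (r : Fin N)) = ∑ v, a v := by
  rw [← Fin.sum_univ_eq_sum_range (fun r => a (i + (r : Fin N)))]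
  simp only [Fin.cast_val_eq_self]
  exact Equiv.sum_comp (Equiv.addLeft i) a

theorem Fin.exists_eq_add_natCast (i v : Fin N) : ∃ r < N, v = i + (r : Fin N) :=
  ⟨(v - i).val, (v - i).isLt, by rw [Fin.cast_val_eq_self]; abel⟩

theorem Fin.sum_add_shift_mul (W : Finset (Fin N)) (z : Fin N → ℕ) :
    ∑ v ∈ W, (z (v - 1) + z v) =
      ∑ v, z v * ((if v + 1 ∈ W then 1 else 0) + if v ∈ W then 1 else 0) := by
  rw [sum_add_distrib]
  simp only [mul_add, sum_add_distrib, mul_ite, mul_one, mul_zero]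
  congr 1
  · rw [← Equiv.sum_comp (Equiv.subRight (1 : Fin N))]
    simp
  · simp

/-- Counted by edges, each edge contributes its multiplicity at least once, as one of its ends lies
in `W`. -/
theorem Fin.sum_le_sum_add_shift_of_cover {W : Finset (Fin N)} (hW : ∀ v, v ∈ W ∨ v + 1 ∈ W)
    (z : Fin N → ℕ) : ∑ v, z v ≤ ∑ v ∈ W, (z (v - 1) + z v) := by
  rw [Fin.sum_add_shift_mul]
  refine sum_le_sum fun v _ => ?_
  rcases hW v with h | h
  · rw [if_pos h]; exact Nat.le_mul_of_pos_right _ (by omega)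
  · rw [if_pos h]; exact Nat.le_mul_of_pos_right _ (by omega)

theorem Fin.le_two_mul_card_of_cover {W : Finset (Fin N)} (hW : ∀ v, v ∈ W ∨ v + 1 ∈ W) :
    N ≤ 2 * W.card := by
  have := Fin.sum_le_sum_add_shift_of_cover hW (fun _ => 1)
  simp at this
  omega

/-- A weighted cycle all of whose vertex covers weigh at least `t`, and whose total weight is at
least `2 * t`, has a matching of size `t`; here `z v` is the multiplicity of `{v, v + 1}`. -/
theorem Fin.exists_matching_of_two_mul_le (hN : 3 ≤ N) (t : ℕ) (a : Fin N → ℕ)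
    (h : ∀ W : Finset (Fin N), (∀ v, v ∈ W ∨ v + 1 ∈ W) → t ≤ ∑ v ∈ W, a v)
    (htot : 2 * t ≤ ∑ v, a v) :
    ∃ z : Fin N → ℕ, (∀ v, z (v - 1) + z v ≤ a v) ∧ t ≤ ∑ v, z v := by
  -- The cycle is rotated so that a vertex of least weight becomes the last one.
  obtain ⟨i, -, hi⟩ := exists_min_image (univ : Finset (Fin N)) a ⟨0, mem_univ _⟩
  obtain ⟨m, rfl⟩ : ∃ m, N = m + 1 := ⟨N - 1, by omega⟩
  have hcast : ∀ r : ℕ, r < m + 1 → ((r : Fin (m + 1)) : ℕ) = r := fun r hr =>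
    Nat.mod_eq_of_lt hr
  have hm1 : i + 1 + (m : Fin (m + 1)) = i := by
    have : ((m + 1 : ℕ) : Fin (m + 1)) = 0 := Fin.natCast_self _
    push_cast at this
    rw [add_assoc, add_comm 1, this, add_zero]
  obtain ⟨y, hy0, hy, hsum⟩ := exists_cycle_matching m t (by omega)
    (fun r => a (i + 1 + (r : Fin (m + 1)))) (by rw [hm1]; exact hi _ (mem_univ _))
    (by rw [hm1]; exact hi _ (mem_univ _)) (by
      intro c hc hcc hc0
      have h1 := h (univ.filter fun v => c (v - (i + 1)).val = 1) (by
        intro v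
        simp only [mem_filter, mem_univ, true_and]
        obtain ⟨r, hr, rfl⟩ := Fin.exists_eq_add_natCast (i + 1) v
        rw [show i + 1 + (r : Fin (m + 1)) + 1 - (i + 1) = ((r + 1 : ℕ) : Fin (m + 1)) by
          push_cast; abel, add_sub_cancel_left, hcast r hr]
        have e0 := hc r
        rcases Nat.lt_or_ge r m with hrm | hrm
        · rw [hcast _ (by omega)]
          have e1 := hc (r + 1)
          have := hcc r hrm
          omega
        · obtain rfl : r = m := by omega
          rw [Fin.natCast_self, Fin.val_zero]
          have := hc 0
          omega)
      refine h1.trans (le_of_eq ?_)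
      rw [sum_filter, ← Fin.sum_add_natCast _ (i + 1)]
      refine sum_congr rfl fun r hr => ?_
      rw [add_sub_cancel_left, hcast r (mem_range.1 hr)]
      have := hc r
      split_ifs with h2
      · rw [h2, one_mul]
      · rw [show c r = 0 by omega, zero_mul])
    (by rwa [Fin.sum_add_natCast])
  -- Vertex `i + 1 + r` has rotated index `r`, so the edge `{v, v + 1}` has multiplicity `y` at `v -
  -- i`.
  refine ⟨fun v => y (v - i).val, fun v => ?_, ?_⟩
  · obtain ⟨r, hr, rfl⟩ := Fin.exists_eq_add_natCast (i + 1) v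
    have := hy r (by omega)
    dsimp only
    rw [show i + 1 + (r : Fin (m + 1)) - 1 - i = (r : Fin (m + 1)) by abel,
      show i + 1 + (r : Fin (m + 1)) - i = ((r + 1 : ℕ) : Fin (m + 1)) by push_cast; abel,
      hcast r hr]
    rcases Nat.lt_or_ge r m with hrm | hrm
    · rw [hcast _ (by omega)]; exact this
    · obtain rfl : r = m := by omega
      rw [Fin.natCast_self, Fin.val_zero, ← hy0]; exact this
  · rw [← Fin.sum_add_natCast _ i]
    refine hsum.trans (le_of_eq (sum_congr rfl fun r hr => ?_))
    rw [add_sub_cancel_left, hcast r (mem_range.1 hr)]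

end Cycle

theorem Fin.exists_matching_or_eq (n t : ℕ) (hn : 1 ≤ n) (ht : n + 1 ≤ t) (htn : t ≤ 2 * n + 1)
    (a : Fin (2 * n + 1) → ℕ)
    (h : ∀ W : Finset (Fin (2 * n + 1)), (∀ v, v ∈ W ∨ v + 1 ∈ W) → t ≤ ∑ v ∈ W, a v) :
    (∃ z : Fin (2 * n + 1) → ℕ, (∀ v, z (v - 1) + z v ≤ a v) ∧ t ≤ ∑ v, z v) ∨
      ∃ z : Fin (2 * n + 1) → ℕ, (∀ v, a v = 1 + (z (v - 1) + z v)) ∧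
        ∑ v, z v = t - (n + 1) := by
  by_cases htot : 2 * t ≤ ∑ v, a v
  · exact Or.inl (Fin.exists_matching_of_two_mul_le (by omega) t a h htot)
  right
  -- `B i` weighs the alternating cover `i + 1, i + 3, …, i`, whose only doubly covered edge is `{i,
  -- i + 1}`; `A i` weighs its complement.
  set B : Fin (2 * n + 1) → ℕ := fun i =>
    ∑ k ∈ range (n + 1), a (i + 1 + ((2 * k : ℕ) : Fin (2 * n + 1))) with hB
  set A : Fin (2 * n + 1) → ℕ := fun i =>
    ∑ k ∈ range n, a (i + 1 + ((2 * k + 1 : ℕ) : Fin (2 * n + 1))) with hA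
  have hAB : ∀ i, B i + A i = ∑ v, a v := fun i => by
    rw [← Fin.sum_add_natCast a (i + 1), sum_range_two_mul_add_one]
  have hBA : ∀ i, B i = A (i - 1) + a i := fun i => by
    have h0 : ((2 * n + 1 : ℕ) : Fin (2 * n + 1)) = 0 := Fin.natCast_self _
    rw [hB, hA]
    dsimp only
    rw [sum_range_succ]
    congr 1
    · refine sum_congr rfl fun k _ => congrArg a ?_
      push_cast; abel
    · refine congrArg a ?_
      rw [add_assoc, add_comm 1, ← Nat.cast_succ, h0, add_zero]
  have hBt : ∀ i, t ≤ B i := fun i => by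
    refine (h ((range (n + 1)).image fun k : ℕ => i + 1 + ((2 * k : ℕ) : Fin (2 * n + 1))) ?_).trans
      (sum_image_le_of_nonneg fun _ _ => Nat.zero_le _)
    intro v
    obtain ⟨r, hr, rfl⟩ := Fin.exists_eq_add_natCast (i + 1) v
    simp only [mem_image, mem_range]
    rcases Nat.even_or_odd' r with ⟨q, rfl | rfl⟩
    · exact Or.inl ⟨q, by omega, rfl⟩
    · exact Or.inr ⟨q + 1, by omega, by push_cast; ring⟩
  have hsumB : ∑ i, B i = (n + 1) * ∑ v, a v := by
    rw [hB, sum_comm]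
    simp only [add_assoc]
    have : ∀ k : ℕ, ∑ i, a (i + (1 + ((2 * k : ℕ) : Fin (2 * n + 1)))) = ∑ v, a v := fun k =>
      Equiv.sum_comp (Equiv.addRight (1 + ((2 * k : ℕ) : Fin (2 * n + 1)))) a
    simp only [this, Finset.sum_const, card_range, smul_eq_mul]
  have havg : (2 * n + 1) * t ≤ (n + 1) * ∑ v, a v := by
    rw [← hsumB]
    simpa using card_nsmul_le_sum univ B t fun i _ => hBt i
  -- A total of at most `2t - 2` would give `(2n+1)t ≤ (n+1)(2t-2)`, that is, `t ≥ 2n + 2`.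
  have htot' : ∑ v, a v = 2 * t - 1 := by
    by_contra hne
    have h1 : ∑ v, a v ≤ 2 * t - 2 := by omega
    have h2 := havg.trans (Nat.mul_le_mul_left _ h1)
    obtain ⟨u, rfl⟩ : ∃ u, t = u + 1 := ⟨t - 1, by omega⟩
    rw [show 2 * (u + 1) - 2 = 2 * u by omega] at h2
    nlinarith
  -- Here `a v = B v - A (v - 1)` and `B v = 2t - 1 - A v`. Since `B ≥ t`, every `A` is at most `t -
  -- 1` and no subtraction truncates.
  have hz : ∀ v, a v = 1 + ((t - 1 - A (v - 1)) + (t - 1 - A v)) := fun v => by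
    have h1 := hAB v
    have h2 := hBA v
    have h3 := hBt v
    have h4 := hAB (v - 1)
    have h5 := hBt (v - 1)
    omega
  refine ⟨fun v => t - 1 - A v, hz, ?_⟩
  have h1 : ∑ v, a v = (2 * n + 1) + 2 * ∑ v, (t - 1 - A v) := by
    have h2 : ∑ v, (t - 1 - A (v - 1)) = ∑ v, (t - 1 - A v) :=
      Equiv.sum_comp (Equiv.subRight (1 : Fin (2 * n + 1))) fun v => t - 1 - A v
    rw [sum_congr rfl fun v _ => hz v, sum_add_distrib, sum_add_distrib, h2]
    simp [two_mul]
  dsimp only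
  omega

/-- The difference `z - w` changes sign at each step; after an odd number of steps around the cycle
it equals its own negative. -/
theorem Fin.eq_of_add_shift_eq {n : ℕ} {z w : Fin (2 * n + 1) → ℕ}
    (h : ∀ v, z (v - 1) + z v = w (v - 1) + w v) : z = w := by
  have key : ∀ v : Fin (2 * n + 1), ∀ r : ℕ,
      (z (v + (r : Fin (2 * n + 1))) : ℤ) - w (v + (r : Fin (2 * n + 1))) =
        (-1) ^ r * ((z v : ℤ) - w v) := by
    intro v r
    induction r with
    | zero => simp
    | succ r ih =>
      have := h (v + ((r + 1 : ℕ) : Fin (2 * n + 1)))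
      rw [show v + ((r + 1 : ℕ) : Fin (2 * n + 1)) - 1 = v + (r : Fin (2 * n + 1)) by
        push_cast; abel] at this
      rw [pow_succ, mul_neg_one, neg_mul, ← ih]
      omega
  funext v
  have := key v (2 * n + 1)
  rw [Fin.natCast_self, add_zero, Odd.neg_one_pow ⟨n, rfl⟩] at this
  omega

end CyclicMatchings

/-! ### Monomials and symbolic powers for the odd cycle -/

section OddCycle

variable {k : Type*} [Field k] {n : ℕ}

theorem cycleGraph_odd_adj_iff (hn : 1 ≤ n) {i j : Fin (2 * n + 1)} :
    (SimpleGraph.cycleGraph (2 * n + 1)).Adj i j ↔ j = i + 1 ∨ i = j + 1 := by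
  obtain ⟨m, rfl⟩ : ∃ m, n = m + 1 := ⟨n - 1, by omega⟩
  have : (SimpleGraph.cycleGraph (2 * (m + 1) + 1)).Adj i j ↔ i - j = 1 ∨ j - i = 1 := Iff.rfl
  rw [this, sub_eq_iff_eq_add', sub_eq_iff_eq_add', or_comm]

theorem isMinimalVertexCover_cycleGraph_cover (hn : 1 ≤ n) {W : Finset (Fin (2 * n + 1))}
    (hW : IsMinimalVertexCover (SimpleGraph.cycleGraph (2 * n + 1)) W) (v : Fin (2 * n + 1)) :
    v ∈ W ∨ v + 1 ∈ W :=
  hW.1 _ _ ((cycleGraph_odd_adj_iff hn).2 (Or.inl rfl))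

/-- The exponent of the product of the edge monomials `(X v * X (v + 1)) ^ z v`. -/
noncomputable def edgeExponent (z : Fin (2 * n + 1) →₀ ℕ) : Fin (2 * n + 1) →₀ ℕ :=
  Finsupp.equivFunOnFinite.symm fun v => z (v - 1) + z v

theorem edgeExponent_apply (z : Fin (2 * n + 1) →₀ ℕ) (v : Fin (2 * n + 1)) :
    edgeExponent z v = z (v - 1) + z v := rfl

theorem edgeExponent_add (z w : Fin (2 * n + 1) →₀ ℕ) :
    edgeExponent (z + w) = edgeExponent z + edgeExponent w := by
  ext v
  simp only [edgeExponent_apply, Finsupp.add_apply]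
  ring

theorem monomial_edgeExponent_single (v : Fin (2 * n + 1)) :
    monomial (edgeExponent (Finsupp.single v 1)) (1 : k) = X v * X (v + 1) := by
  have h : edgeExponent (Finsupp.single v 1) = Finsupp.single v 1 + Finsupp.single (v + 1) 1 := by
    ext u
    simp only [edgeExponent_apply, Finsupp.add_apply, Finsupp.single_apply]
    rw [add_comm]
    simp only [eq_sub_iff_add_eq]
  rw [h, X, X, monomial_mul, one_mul]

theorem sum_edgeExponent (z : Fin (2 * n + 1) →₀ ℕ) :
    ∑ v, edgeExponent z v = 2 * ∑ v, z v := by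
  simp only [edgeExponent_apply, Finset.sum_add_distrib]
  rw [two_mul (∑ v, z v)]
  congr 1
  exact Equiv.sum_comp (Equiv.subRight (1 : Fin (2 * n + 1))) z

theorem monomial_edgeExponent_eq_prod (z : Fin (2 * n + 1) →₀ ℕ) :
    monomial (edgeExponent z) (1 : k) = ∏ v, (X v * X (v + 1)) ^ z v := by
  induction z using Finsupp.induction_linear with
  | zero =>
    rw [show edgeExponent (0 : Fin (2 * n + 1) →₀ ℕ) = 0 by ext; simp [edgeExponent_apply]]
    simp
  | add z w hz hw =>
    rw [edgeExponent_add, ← one_mul (1 : k), ← monomial_mul, hz, hw, ← Finset.prod_mul_distrib]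
    simp only [Finsupp.add_apply, pow_add]
  | single v e =>
    have : ∀ e : ℕ, monomial (edgeExponent (Finsupp.single v e)) (1 : k) =
        (X v * X (v + 1)) ^ e := by
      intro e
      induction e with
      | zero =>
        rw [show edgeExponent (Finsupp.single v 0) = 0 by ext; simp [edgeExponent_apply]]
        simp
      | succ e ih =>
        rw [Finsupp.single_add, edgeExponent_add, ← one_mul (1 : k), ← monomial_mul, ih,
          monomial_edgeExponent_single, pow_succ]
    rw [this, Finset.prod_eq_single v]
    · simp
    · intro u _ hu
      rw [Finsupp.single_eq_of_ne hu, pow_zero]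
    · simp

/-- The exponents of the monomials `(∏ v, X v) * p`, `p` a product of `s` edge monomials of the
odd cycle. -/
noncomputable def vertexEdgeExponents (n s : ℕ) : Finset (Fin (2 * n + 1) →₀ ℕ) :=
  (Finset.univ.finsuppAntidiag s).image fun z =>
    Finsupp.equivFunOnFinite.symm (fun _ => 1) + edgeExponent z

theorem mem_vertexEdgeExponents {s : ℕ} {m : Fin (2 * n + 1) →₀ ℕ} :
    m ∈ vertexEdgeExponents n s ↔
      ∃ z : Fin (2 * n + 1) →₀ ℕ, ∑ v, z v = s ∧ ∀ v, m v = 1 + (z (v - 1) + z v) := by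
  simp only [vertexEdgeExponents, Finset.mem_image, Finset.mem_finsuppAntidiag]
  constructor
  · rintro ⟨z, ⟨hz, -⟩, rfl⟩
    exact ⟨z, hz, fun v => rfl⟩
  · rintro ⟨z, hz, hm⟩
    exact ⟨z, ⟨hz, Finset.subset_univ _⟩, by ext v; exact (hm v).symm⟩

theorem card_vertexEdgeExponents (n s : ℕ) :
    (vertexEdgeExponents n s).card = (2 * n + 1).multichoose s := by
  rw [vertexEdgeExponents, Finset.card_image_of_injective,
    Finset.card_finsuppAntidiag_nat_eq_multichoose, Finset.card_univ, Fintype.card_fin]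
  intro z w hzw
  exact DFunLike.coe_injective (Fin.eq_of_add_shift_eq fun v =>
    DFunLike.congr_fun (add_left_cancel hzw) v)

theorem degree_vertexEdgeExponents {s : ℕ} {m : Fin (2 * n + 1) →₀ ℕ}
    (hm : m ∈ vertexEdgeExponents n s) : m.degree = 2 * n + 1 + 2 * s := by
  obtain ⟨z, hz, hm⟩ := mem_vertexEdgeExponents.1 hm
  have := sum_edgeExponent z
  simp only [edgeExponent_apply] at this
  rw [Finsupp.degree_eq_sum, Finset.sum_congr rfl fun v _ => hm v, Finset.sum_add_distrib, this, hz]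
  simp

theorem exists_edgeExponent_of_edges (hn : 1 ≤ n)
    (E : Multiset (MvPolynomial (Fin (2 * n + 1)) k))
    (hE : ∀ e ∈ E, e ∈ edgeMonomials k (SimpleGraph.cycleGraph (2 * n + 1))) :
    ∃ z : Fin (2 * n + 1) →₀ ℕ, ∑ v, z v = E.card ∧ E.prod = monomial (edgeExponent z) 1 := by
  induction E using Multiset.induction with
  | empty =>
    refine ⟨0, by simp, ?_⟩
    rw [show edgeExponent (0 : Fin (2 * n + 1) →₀ ℕ) = 0 by ext; simp [edgeExponent_apply]]
    simp
  | cons e E ih =>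
    obtain ⟨z, hz, hprod⟩ := ih fun e he => hE e (Multiset.mem_cons_of_mem he)
    obtain ⟨v, rfl⟩ : ∃ v, e = X v * X (v + 1) := by
      obtain ⟨i, j, hij, rfl⟩ := hE e (Multiset.mem_cons_self e E)
      rcases (cycleGraph_odd_adj_iff hn).1 hij with rfl | rfl
      · exact ⟨i, rfl⟩
      · exact ⟨j, mul_comm _ _⟩
    refine ⟨Finsupp.single v 1 + z, ?_, ?_⟩
    · simp only [Finsupp.add_apply, Finset.sum_add_distrib, hz, Multiset.card_cons]
      rw [add_comm]
      simp [Finsupp.single_apply]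
    · rw [Multiset.prod_cons, hprod, edgeExponent_add, ← one_mul (1 : k), ← monomial_mul,
        monomial_edgeExponent_single, one_mul]

theorem prod_X_mul_monomial_edgeExponent (z : Fin (2 * n + 1) →₀ ℕ) :
    (∏ v, X v) * monomial (edgeExponent z) (1 : k) =
      monomial (Finsupp.equivFunOnFinite.symm (fun _ => 1) + edgeExponent z) 1 := by
  have h : (∏ v, X v : MvPolynomial (Fin (2 * n + 1)) k) =
      monomial (Finsupp.equivFunOnFinite.symm fun _ => 1) 1 := by
    rw [monomial_eq, Finsupp.prod_fintype _ _ (fun _ => pow_zero _)]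
    simp
  rw [h, monomial_mul, one_mul]

theorem vertexProductTimesEdges_cycleGraph (hn : 1 ≤ n) (s : ℕ) :
    vertexProductTimesEdges k (SimpleGraph.cycleGraph (2 * n + 1)) s =
      (fun m => monomial m (1 : k)) '' (vertexEdgeExponents n s : Set _) := by
  ext f
  simp only [Set.mem_image, Finset.mem_coe, vertexEdgeExponents, Finset.mem_image,
    Finset.mem_finsuppAntidiag]
  constructor
  · rintro ⟨E, hE, rfl, rfl⟩
    obtain ⟨z, hz, hprod⟩ := exists_edgeExponent_of_edges hn E hE
    exact ⟨_, ⟨z, ⟨hz, Finset.subset_univ _⟩, rfl⟩, by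
      rw [hprod, prod_X_mul_monomial_edgeExponent]⟩
  · rintro ⟨_, ⟨z, ⟨hz, -⟩, rfl⟩, rfl⟩
    refine ⟨∑ v, z v • {X v * X (v + 1)}, ?_, ?_, ?_⟩
    · intro e he
      obtain ⟨v, -, hv⟩ := Multiset.mem_sum.1 he
      rw [Multiset.mem_singleton.1 (Multiset.mem_of_mem_nsmul hv)]
      exact ⟨v, v + 1, (cycleGraph_odd_adj_iff hn).2 (Or.inl rfl), rfl⟩
    · rw [← hz]; simp
    · rw [← prod_X_mul_monomial_edgeExponent, monomial_edgeExponent_eq_prod, Multiset.prod_sum]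
      simp only [Multiset.prod_nsmul, Multiset.prod_singleton]

/-- A cover has at least `n + 1` vertices, which accounts for the product of all variables, and it
meets each of the `t - (n + 1)` edges. -/
theorem monomial_mem_symbolicPower (hn : 1 ≤ n) {t : ℕ} (ht : n + 1 ≤ t)
    {m : Fin (2 * n + 1) →₀ ℕ} (hm : m ∈ vertexEdgeExponents n (t - (n + 1))) :
    monomial m (1 : k) ∈
      symbolicPower (edgeIdeal k (SimpleGraph.cycleGraph (2 * n + 1))) t := by
  rw [mem_symbolicPower_edgeIdeal]
  intro m' hm' W hW
  obtain rfl := Finset.mem_singleton.1 (support_monomial_subset hm')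
  obtain ⟨z, hz, hmz⟩ := mem_vertexEdgeExponents.1 hm
  have hcov := isMinimalVertexCover_cycleGraph_cover hn hW
  have h1 := Fin.sum_le_sum_add_shift_of_cover hcov z
  have h2 := Fin.le_two_mul_card_of_cover hcov
  rw [Finset.sum_congr rfl fun v _ => hmz v, Finset.sum_add_distrib, Finset.sum_const, smul_eq_mul,
    mul_one]
  omega

theorem monomial_mem_edgeIdeal_pow (hn : 1 ≤ n) {t : ℕ} {m : Fin (2 * n + 1) →₀ ℕ} (c : k)
    (z : Fin (2 * n + 1) →₀ ℕ) (hz : ∀ v, z (v - 1) + z v ≤ m v) (ht : t ≤ ∑ v, z v) :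
    monomial m c ∈ edgeIdeal k (SimpleGraph.cycleGraph (2 * n + 1)) ^ t := by
  have hle : edgeExponent z ≤ m := hz
  rw [← tsub_add_cancel_of_le hle, ← mul_one c, ← monomial_mul, monomial_edgeExponent_eq_prod]
  refine Ideal.mul_mem_left _ _ (Ideal.pow_le_pow_right ht ?_)
  rw [← Finset.prod_pow_eq_pow_sum]
  exact Ideal.prod_mem_prod fun v _ =>
    Ideal.pow_mem_pow (X_mul_X_mem_edgeIdeal ((cycleGraph_odd_adj_iff hn).2 (Or.inl rfl))) _

theorem symbolicPower_cycleGraph_eq (hn : 1 ≤ n) {t : ℕ} (ht : n + 1 ≤ t) (htn : t ≤ 2 * n + 1) :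
    symbolicPower (edgeIdeal k (SimpleGraph.cycleGraph (2 * n + 1))) t =
      edgeIdeal k (SimpleGraph.cycleGraph (2 * n + 1)) ^ t ⊔
        Ideal.span ((fun m => monomial m (1 : k)) ''
          (vertexEdgeExponents n (t - (n + 1)) : Set _)) := by
  apply le_antisymm
  · intro f hf
    rw [mem_symbolicPower_edgeIdeal] at hf
    rw [f.as_sum]
    refine Ideal.sum_mem _ fun m hm => ?_
    rcases Fin.exists_matching_or_eq n t hn ht htn m (by
      intro W hW
      obtain ⟨W', hsub, hmin⟩ := exists_isMinimalVertexCover_subset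
        (SimpleGraph.cycleGraph (2 * n + 1)) W (by
          intro i j hij
          rcases (cycleGraph_odd_adj_iff hn).1 hij with rfl | rfl
          · exact hW i
          · exact (hW j).symm)
      exact (hf m hm W' hmin).trans (Finset.sum_le_sum_of_subset hsub)) with ⟨z, hz, hzt⟩ | ⟨z, hz, hzt⟩
    · exact Ideal.mem_sup_left
        (monomial_mem_edgeIdeal_pow hn _ (Finsupp.equivFunOnFinite.symm z) hz hzt)
    · refine Ideal.mem_sup_right ?_
      rw [← mul_one (coeff m f), ← C_mul_monomial]
      refine Ideal.mul_mem_left _ _ (Ideal.subset_span ⟨m, ?_, rfl⟩)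
      exact mem_vertexEdgeExponents.2 ⟨Finsupp.equivFunOnFinite.symm z, hzt, hz⟩
  · refine sup_le (edgeIdeal_pow_le_symbolicPower t) (Ideal.span_le.2 ?_)
    rintro _ ⟨m, hm, rfl⟩
    exact monomial_mem_symbolicPower hn ht hm

end OddCycle

/-! ### The main theorem -/

theorem mainTheorem4 (k : Type*) [Field k] (n t : ℕ) (hnt : n + 2 ≤ t) (htn : t ≤ 2 * n + 1) :
    symbolicDefect (edgeIdeal k (SimpleGraph.cycleGraph (2 * n + 1))) t =
        ∑ l ∈ Finset.Icc 1 (2 * n + 1),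
          (2 * n + 1).choose l * intMultichoose l ((t : ℤ) - ((n : ℤ) + 1) - (l : ℤ)) ∧
      (vertexProductTimesEdges k (SimpleGraph.cycleGraph (2 * n + 1)) (t - (n + 1))).ncard =
        symbolicDefect (edgeIdeal k (SimpleGraph.cycleGraph (2 * n + 1))) t ∧
      symbolicPower (edgeIdeal k (SimpleGraph.cycleGraph (2 * n + 1))) t =
        edgeIdeal k (SimpleGraph.cycleGraph (2 * n + 1)) ^ t ⊔
          Ideal.span
            (vertexProductTimesEdges k (SimpleGraph.cycleGraph (2 * n + 1)) (t - (n + 1))) := by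
  have hn : 1 ≤ n := by omega
  have hsymb := symbolicPower_cycleGraph_eq (k := k) hn (by omega : n + 1 ≤ t) htn
  have hdefect : symbolicDefect (edgeIdeal k (SimpleGraph.cycleGraph (2 * n + 1))) t =
      (2 * n + 1).multichoose (t - (n + 1)) := by
    rw [← card_vertexEdgeExponents]
    -- The degree is `2n + 1 + 2(t - n - 1) = 2t - 1`, just below the least degree in `I^t`.
    refine spanFinrank_quotient_eq_card (d := 2 * t - 1) (fun m hm => ?_) (fun f hf m hm => ?_) hsymb
    · rw [degree_vertexEdgeExponents hm]; omega
    · have := two_mul_le_degree_of_mem_edgeIdeal_pow hf m hm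
      omega
  refine ⟨?_, ?_, ?_⟩
  · rw [hdefect, ← choose_mul_intMultichoose_sum _ _ (by omega) (by omega)]
    refine Finset.sum_congr rfl fun l _ => ?_
    rw [show (((t - (n + 1) : ℕ) : ℤ)) = (t : ℤ) - ((n : ℤ) + 1) by omega]
  · rw [hdefect, vertexProductTimesEdges_cycleGraph hn,
      Set.ncard_image_of_injective _ (monomial_left_injective one_ne_zero),
      Set.ncard_coe_finset, card_vertexEdgeExponents]
  · rw [hsymb, vertexProductTimesEdges_cycleGraph hn]
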